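/- For every constant $c>0$ there are constants $C>0$ and $A\in\mathbb{N}$, depending only on $c$, such that the following holds. Let $G=(V,E,w)$ be a finite simple graph with $n=|V|$ vertices and pairwise distinct real edge weights, let $0<p\le 1$, and let $k\ge c\log n$ be an integer. Let $H$ be a random spanning subgraph of $G$ obtained by sampling the edges of $G$ with a $k$-wise independent sampler with probability $p$; that is, every edge of $G$ belongs to $H$ with probability $p$, and for every set of at most $k$ edges of $G$ the events that these edges belong to $H$ are mutually independent. Let $F$ be the maximal minimum weight spanning forest of $H$, i.e. the maximal acyclic subgraph of $H$ of minimum total weight. Call an edge $\{u,v\}$ of $G$ $F$-light if $w(u,v)\le w_F(u,v)$, where $w_F(u,v)$ is the maximum weight of an edge on the path from $u$ to $v$ in $F$, and $w_F(u,v)=\infty$ if there is no such path. Then, with probability at least $1-\frac1n$, the number of $F$-light edges of $G$ is at most $$C\,(\log n)^{A}\cdot\frac{n}{p}.$$ In particular, for $\Theta(\log n)$-wise independent sampling, the number of $F$-light edges of $G$ is $\widetilde O(n/p)$ with high probability. -/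

import Mathlib

open MeasureTheory ProbabilityTheory

universe u v

/-- Total weight of the edges of a finite graph. -/
noncomputable def graphWeight {V : Type u} [Fintype V] (w : Sym2 V → ℝ) (F : SimpleGraph V) : ℝ :=
  ∑ᶠ e ∈ F.edgeSet, w e

/-- `F` is a maximal spanning forest of `H`: an inclusion-maximal acyclic subgraph of `H`
(all graphs here have the whole of `V` as vertex set). -/
def IsMaximalForest {V : Type u} (H F : SimpleGraph V) : Prop :=
  Maximal (fun F' : SimpleGraph V => F' ≤ H ∧ F'.IsAcyclic) F

/-- `F` is a maximal minimum weight spanning forest of `H` for the edge weights `w`. -/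
def IsMinWeightForest {V : Type u} [Fintype V] (w : Sym2 V → ℝ) (H F : SimpleGraph V) : Prop :=
  IsMaximalForest H F ∧
    ∀ F' : SimpleGraph V, IsMaximalForest H F' → graphWeight w F ≤ graphWeight w F'

/-- `w_F(x, y)`: the maximum weight of an edge on the path from `x` to `y` in the forest `F`,
and `⊤` if there is no such path. The infimum is over a type with at most one element, since
paths in a forest are unique. -/
noncomputable def maxPathWeight {V : Type u} (w : Sym2 V → ℝ) (F : SimpleGraph V) (x y : V) :
    EReal :=
  ⨅ P : F.Path x y, ⨆ e ∈ (P : F.Walk x y).edges, (w e : EReal)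

/-- The set of `F`-light edges of `G`: the edges `{x, y}` of `G` that do not satisfy
`w(x, y) > w_F(x, y)`. -/
def lightEdges {V : Type u} (w : Sym2 V → ℝ) (G F : SimpleGraph V) : Set (Sym2 V) :=
  {e | e ∈ G.edgeSet ∧ ∀ x y : V, e = s(x, y) → (w e : EReal) ≤ maxPathWeight w F x y}

/-- The random spanning subgraph `H` of `G` is obtained by sampling every edge of `G` with
probability `p` using a `k`-wise independent sampler: every edge is kept with probability `p`,
and the events that the edges of `T` are kept are mutually independent for every set `T` of at
most `k` edges. -/
structure IsKWiseSample {V : Type u} {Ω : Type v} [MeasurableSpace Ω] (μ : Measure Ω)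
    (G : SimpleGraph V) (p : ℝ) (k : ℕ) (H : Ω → SimpleGraph V) : Prop where
  le : ∀ ω, H ω ≤ G
  measurableSet : ∀ e ∈ G.edgeSet, MeasurableSet {ω | e ∈ (H ω).edgeSet}
  prob : ∀ e ∈ G.edgeSet, μ.real {ω | e ∈ (H ω).edgeSet} = p
  indep : ∀ T : Finset (Sym2 V), (T : Set (Sym2 V)) ⊆ G.edgeSet → T.card ≤ k →
    iIndepSet (fun e : T => {ω | (e : Sym2 V) ∈ (H ω).edgeSet}) μ

set_option linter.unusedSectionVars false

/-! An edge of G whose endpoints are joined in H by strictly lighter edges is not F-light: a forest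
edge of weight at least `w e` on the path could be exchanged for a lighter one
(`IsMinWeightForest.maxPathWeight_lt`). So it suffices to find, for all but few edges e, a set of
lighter edges whose sample very probably connects the ends of e.

Such sets are expanders of minimum degree D about (log n)^4 / p and conductance about 1 / log n. Any
set of 2Dn(1 + log₂ n) edges contains an edge spanned by an expander of lighter edges of the set
(`exists_isEdgeExpander`). Applied to the set of all edges not spanned in this way, this bounds
their number.

Limited independence enters only in showing that a sampled expander stays connected
(`IsEdgeExpander.exists_measurableSet_reachable`). Attach to each edge its degree-normalized
incidence vector β_e and consider the random matrix M, the sum of y_e β_e β_eᵀ with y_e the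
indicator of e centred at p. If the sample misses the cut of A, the indicator of A scaled by root
degrees is a test vector on which the quadratic form of M is at most -pφ times its squared norm.
Hence the trace of an even power of M is at least that power of pφ. By Markov this is unlikely: the
expected trace of the power 2r is a sum over closed walks of 2r edges, each term a mixed moment of
at most 2r distinct edges, so 2r-wise independence suffices. Taking 2r a power of two of order log n
gives a failure probability small enough for a union bound over the spanned edges. -/

/-! ### Minimum weight forests and the exchange argument -/

/-- The edges of `H` of weight less than `t`. -/
def edgesBelow {V : Type u} (w : Sym2 V → ℝ) (H : SimpleGraph V) (t : ℝ) : SimpleGraph V :=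
  SimpleGraph.fromEdgeSet {e | e ∈ H.edgeSet ∧ w e < t}

lemma edgesBelow_adj {V : Type u} {w : Sym2 V → ℝ} {H : SimpleGraph V} {t : ℝ} {x y : V} :
    (edgesBelow w H t).Adj x y ↔ H.Adj x y ∧ w s(x, y) < t := by
  simp only [edgesBelow, SimpleGraph.fromEdgeSet_adj, Set.mem_ofPred_eq, SimpleGraph.mem_edgeSet]
  exact ⟨fun h => h.1, fun h => ⟨h, h.1.ne⟩⟩

lemma reachable_of_forall_adj {V : Type u} {F F' : SimpleGraph V}
    (h : ∀ x y, F.Adj x y → F'.Reachable x y) {x y : V} (hxy : F.Reachable x y) :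
    F'.Reachable x y := by
  obtain ⟨p⟩ := hxy
  induction p with
  | nil => exact SimpleGraph.Reachable.refl _
  | cons hadj _ ih => exact (h _ _ hadj).trans ih

/-- Exchanging an edge of a forest for an edge joining the two parts that its removal leaves. -/
lemma isMaximalForest_exchange {V : Type u} {H F : SimpleGraph V} (hF : IsMaximalForest H F)
    {a b x y : V} (hxy : H.Adj x y) (hF0 : ¬ (F.deleteEdges {s(a, b)}).Reachable x y)
    (hne : s(x, y) ≠ s(a, b)) :
    IsMaximalForest H (F.deleteEdges {s(a, b)} ⊔ SimpleGraph.edge x y) := by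
  have hle : F.deleteEdges {s(a, b)} ≤ F := SimpleGraph.deleteEdges_le _
  have hreach := SimpleGraph.reachable_eq_of_maximal_isAcyclic F hF
  have hacyc : (F.deleteEdges {s(a, b)} ⊔ SimpleGraph.edge x y).IsAcyclic :=
    (hF.prop.2.anti hle).sup_edge_of_not_reachable hF0
  have hle' : F.deleteEdges {s(a, b)} ⊔ SimpleGraph.edge x y ≤ H :=
    sup_le (hle.trans hF.prop.1) ((SimpleGraph.edge_le_iff _).2 (Or.inr hxy))
  have hnadj : ¬ F.Adj x y := fun h => hF0
    (SimpleGraph.Adj.reachable (by simpa [SimpleGraph.deleteEdges_adj, h] using hne))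
  have hFle : F ≤ F.deleteEdges {s(a, b)} ⊔ SimpleGraph.edge a b := by
    intro c d hcd
    by_cases h : s(c, d) = s(a, b)
    · right
      rw [SimpleGraph.edge_adj]
      exact ⟨by simpa using h, hcd.ne⟩
    · left
      exact SimpleGraph.deleteEdges_adj.2 ⟨hcd, by simpa using h⟩
  -- If a and b were still apart, adding their edge back would keep the graph acyclic, so F together
  -- with xy would be acyclic, against the maximality of F.
  have hab : (F.deleteEdges {s(a, b)} ⊔ SimpleGraph.edge x y).Reachable a b := by
    by_contra hab
    have h1 := hacyc.sup_edge_of_not_reachable hab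
    have h2 : (F ⊔ SimpleGraph.edge x y).IsAcyclic := by
      refine h1.anti (sup_le (hFle.trans ?_) ?_)
      · exact sup_le_sup_right le_sup_left _
      · exact le_sup_right.trans le_sup_left
    rcases (SimpleGraph.isAcyclic_sup_fromEdgeSet_iff.1 h2).2
      (by rw [hreach]; exact hxy.reachable) with h | h
    · exact hxy.ne h
    · exact hnadj h
  refine (SimpleGraph.maximal_isAcyclic_iff_reachable_eq hle' hacyc).2 ?_
  ext c d
  refine ⟨fun h => h.mono hle', fun h => ?_⟩
  rw [← hreach] at h
  refine reachable_of_forall_adj (fun c d hcd => ?_) h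
  rcases hFle hcd with h | h
  · exact (SimpleGraph.Adj.reachable h).mono le_sup_left
  · rw [SimpleGraph.edge_adj] at h
    rcases h.1 with ⟨rfl, rfl⟩ | ⟨rfl, rfl⟩
    · exact hab
    · exact hab.symm

lemma graphWeight_exchange {V : Type u} [Fintype V] (w : Sym2 V → ℝ) {F : SimpleGraph V}
    {a b x y : V} (hab : F.Adj a b) (hxy : x ≠ y) (hnadj : ¬ F.Adj x y) :
    graphWeight w (F.deleteEdges {s(a, b)} ⊔ SimpleGraph.edge x y) + w s(a, b) =
      graphWeight w F + w s(x, y) := by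
  unfold graphWeight
  have h1 : (F.deleteEdges {s(a, b)} ⊔ SimpleGraph.edge x y).edgeSet =
      insert s(x, y) (F.edgeSet \ {s(a, b)}) := by
    rw [SimpleGraph.edgeSet_sup, SimpleGraph.edgeSet_deleteEdges,
      SimpleGraph.edgeSet_edge_of_ne hxy, Set.union_singleton]
  have h2 : F.edgeSet = insert s(a, b) (F.edgeSet \ {s(a, b)}) := by
    rw [Set.insert_sdiff_singleton, Set.insert_eq_of_mem]
    exact hab
  rw [h1, finsum_mem_insert w (fun h => hnadj h.1) (Set.toFinite _)]
  conv_rhs => rw [h2]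
  rw [finsum_mem_insert w (by simp) (Set.toFinite _)]
  ring

/-- If the endpoints of a pair are joined in `H` by edges lighter than `t`, they are joined by such
edges in a minimum weight spanning forest. -/
theorem IsMinWeightForest.maxPathWeight_lt {V : Type u} [Fintype V] {w : Sym2 V → ℝ}
    {H F : SimpleGraph V} (hF : IsMinWeightForest w H F) {u v : V} {t : ℝ}
    (huv : (edgesBelow w H t).Reachable u v) : maxPathWeight w F u v < t := by
  classical
  have hreach := SimpleGraph.reachable_eq_of_maximal_isAcyclic F hF.1
  have hle : edgesBelow w H t ≤ H := fun x y h => (edgesBelow_adj.1 h).1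
  have hFuv : F.Reachable u v := by rw [hreach]; exact huv.mono hle
  obtain ⟨P, hP⟩ := hFuv.exists_isPath
  have key : ∀ f ∈ P.edges, w f < t := by
    intro f hf
    by_contra hft
    push Not at hft
    induction f with
    | h a b =>
    have hab : F.Adj a b := P.adj_of_mem_edges hf
    have hnr : ¬ (F.deleteEdges {s(a, b)}).Reachable u v := by
      intro h
      obtain ⟨q, hq⟩ := h.exists_isPath
      have hq' := (SimpleGraph.Walk.isPath_mapLe (SimpleGraph.deleteEdges_le (G := F) {s(a, b)})).2 hq
      have := (hF.1.prop.2.subsingleton_path u v).elim ⟨P, hP⟩ ⟨_, hq'⟩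
      have h3 : P = q.mapLe (SimpleGraph.deleteEdges_le (G := F) {s(a, b)}) :=
        congrArg Subtype.val this
      rw [h3, SimpleGraph.Walk.edges_mapLe_eq_edges] at hf
      have := q.adj_of_mem_edges hf
      simp at this
    obtain ⟨q⟩ := huv
    -- Deleting ab separates u from v in F, so the light walk crosses this cut; exchanging ab for
    -- the crossing edge strictly lowers the weight.
    obtain ⟨d, -, hd1, hd2⟩ := q.exists_boundary_dart
      {z | (F.deleteEdges {s(a, b)}).Reachable u z} (SimpleGraph.Reachable.refl _) hnr
    obtain ⟨hH, hw⟩ := edgesBelow_adj.1 d.adj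
    have hne : s(d.fst, d.snd) ≠ s(a, b) := fun h => by rw [h] at hw; linarith
    have hnr' : ¬ (F.deleteEdges {s(a, b)}).Reachable d.fst d.snd := fun h =>
      hd2 (SimpleGraph.Reachable.trans hd1 h)
    have h1 := hF.2 _ (isMaximalForest_exchange hF.1 hH hnr' hne)
    have h2 := graphWeight_exchange w hab hH.ne (fun h => hnr' (SimpleGraph.Adj.reachable
      (SimpleGraph.deleteEdges_adj.2 ⟨h, by simpa using hne⟩)))
    linarith
  refine (iInf_le _ (⟨P, hP⟩ : F.Path u v)).trans_lt ?_
  have : (⨆ e ∈ P.edges, (w e : EReal)) = P.edges.toFinset.sup (fun e => (w e : EReal)) := by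
    rw [Finset.sup_eq_iSup]; simp
  -- The side condition handles the empty path, whose supremum is `⊥`.
  rw [this, Finset.sup_lt_iff (EReal.bot_lt_coe t)]
  intro e he
  exact_mod_cast key e (by simpa using he)

/-! ### Quadratic forms and traces of powers -/

open scoped Matrix in
/-- A lower bound on a quadratic form passes to the powers `M ^ 2 ^ s` of a symmetric matrix. -/
lemma pow_dotProduct_le {V : Type*} [Fintype V] [DecidableEq V] {M : Matrix V V ℝ}
    (hM : Mᵀ = M) {x : V → ℝ} (hx : 0 < x ⬝ᵥ x) {r : ℝ} (hr : 0 ≤ r)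
    (h : r * (x ⬝ᵥ x) ≤ |x ⬝ᵥ M *ᵥ x|) (s : ℕ) :
    r ^ 2 ^ s * (x ⬝ᵥ x) ≤ |x ⬝ᵥ (M ^ 2 ^ s) *ᵥ x| := by
  induction s with
  | zero => simpa using h
  | succ s ih =>
    have hsym : (M ^ 2 ^ s)ᵀ = M ^ 2 ^ s := by rw [Matrix.transpose_pow, hM]
    set N := M ^ 2 ^ s with hN
    have h1 : x ⬝ᵥ (M ^ 2 ^ (s + 1)) *ᵥ x = (N *ᵥ x) ⬝ᵥ (N *ᵥ x) := by
      rw [pow_succ, pow_mul, ← hN, sq, ← Matrix.mulVec_mulVec, Matrix.dotProduct_mulVec,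
        ← Matrix.mulVec_transpose, hsym]
    -- Cauchy–Schwarz replaces the spectral theorem, at the price of reaching only exponents that
    -- are powers of two.
    have h2 : (x ⬝ᵥ N *ᵥ x) ^ 2 ≤ (x ⬝ᵥ x) * ((N *ᵥ x) ⬝ᵥ (N *ᵥ x)) := by
      simpa [dotProduct, sq] using Finset.sum_mul_sq_le_sq_mul_sq Finset.univ x (N *ᵥ x)
    rw [h1]
    have h3 : (r ^ 2 ^ s * (x ⬝ᵥ x)) ^ 2 ≤ (x ⬝ᵥ N *ᵥ x) ^ 2 := by
      rw [← sq_abs (x ⬝ᵥ N *ᵥ x)]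
      exact pow_le_pow_left₀ (by positivity) ih 2
    refine le_trans ?_ (le_abs_self _)
    refine le_of_mul_le_mul_left (?_ : (x ⬝ᵥ x) * _ ≤ (x ⬝ᵥ x) * _) hx
    calc _ = (r ^ 2 ^ s * (x ⬝ᵥ x)) ^ 2 := by rw [pow_succ, pow_mul]; ring
      _ ≤ _ := h3.trans h2

-- The form is the squared norm of Nx and the trace is the squared Frobenius norm of N, so this is
-- Cauchy–Schwarz row by row.
open scoped Matrix in
lemma dotProduct_mul_self_mulVec_le_trace {V : Type*} [Fintype V] [DecidableEq V]
    {N : Matrix V V ℝ} (hN : Nᵀ = N) (x : V → ℝ) :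
    |x ⬝ᵥ (N * N) *ᵥ x| ≤ (N * N).trace * (x ⬝ᵥ x) := by
  have h1 : x ⬝ᵥ (N * N) *ᵥ x = (N *ᵥ x) ⬝ᵥ (N *ᵥ x) := by
    rw [← Matrix.mulVec_mulVec, Matrix.dotProduct_mulVec, ← Matrix.mulVec_transpose, hN]
  have h2 : (N * N).trace = ∑ i, ∑ j, N i j ^ 2 := by
    conv_lhs => rw [← hN]
    simp only [Matrix.trace, Matrix.diag, Matrix.mul_apply, Matrix.transpose_apply]
    rw [Finset.sum_comm]
    rw [Finset.sum_comm]
    refine Finset.sum_congr rfl fun i _ => Finset.sum_congr rfl fun j _ => ?_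
    have : N i j = N j i := by conv_lhs => rw [← hN, Matrix.transpose_apply]
    rw [sq, this]
  rw [h1, abs_of_nonneg (by simp only [dotProduct]; exact Finset.sum_nonneg fun i _ => mul_self_nonneg _), h2,
    Finset.sum_mul]
  refine Finset.sum_le_sum fun i _ => ?_
  have := Finset.sum_mul_sq_le_sq_mul_sq Finset.univ (N i) x
  simpa [Matrix.mulVec, dotProduct, sq] using this

open scoped Matrix in
lemma pow_le_trace_pow {V : Type*} [Fintype V] [DecidableEq V] {M : Matrix V V ℝ}
    (hM : Mᵀ = M) {x : V → ℝ} (hx : 0 < x ⬝ᵥ x) {r : ℝ} (hr : 0 ≤ r)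
    (h : r * (x ⬝ᵥ x) ≤ |x ⬝ᵥ M *ᵥ x|) (s : ℕ) :
    r ^ 2 ^ (s + 1) ≤ (M ^ 2 ^ (s + 1)).trace := by
  have h1 := pow_dotProduct_le hM hx hr h (s + 1)
  have h2 : M ^ 2 ^ (s + 1) = M ^ 2 ^ s * M ^ 2 ^ s := by rw [← pow_add]; congr 1; ring
  rw [h2] at h1 ⊢
  have := dotProduct_mul_self_mulVec_le_trace
    (show (M ^ 2 ^ s)ᵀ = M ^ 2 ^ s by rw [Matrix.transpose_pow, hM]) x
  exact le_of_mul_le_mul_right (h1.trans this) hx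

/-! ### Traces as sums over closed walks -/

section Gram

variable {E V : Type*} [Fintype E] [DecidableEq E] [Fintype V] [DecidableEq V]

/-- The weighted sum `∑ e, y e • β e (β e)ᵀ` of rank one matrices. -/
def rankOneSum (β : E → V → ℝ) (y : E → ℝ) : Matrix V V ℝ :=
  ∑ e, y e • Matrix.vecMulVec (β e) (β e)

open scoped Matrix in
lemma rankOneSum_transpose (β : E → V → ℝ) (y : E → ℝ) :
    (rankOneSum β y)ᵀ = rankOneSum β y := by
  simp [rankOneSum, Matrix.transpose_sum, Matrix.transpose_vecMulVec]

open scoped Matrix in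
lemma dotProduct_rankOneSum_mulVec (β : E → V → ℝ) (y : E → ℝ) (x : V → ℝ) :
    x ⬝ᵥ rankOneSum β y *ᵥ x = ∑ e, y e * (β e ⬝ᵥ x) ^ 2 := by
  simp only [rankOneSum, Matrix.sum_mulVec, dotProduct_sum, Matrix.smul_mulVec,
    Matrix.vecMulVec_mulVec, dotProduct_smul]
  refine Finset.sum_congr rfl fun e _ => ?_
  simp [dotProduct_comm x, sq]

lemma rankOneSum_pow_succ (β : E → V → ℝ) (y : E → ℝ) (k : ℕ) :
    rankOneSum β y ^ (k + 1) = ∑ f : Fin (k + 1) → E,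
      ((∏ i, y (f i)) * ∏ i : Fin k, (β (f i.castSucc) ⬝ᵥ β (f i.succ))) •
        Matrix.vecMulVec (β (f 0)) (β (f (Fin.last k))) := by
  induction k with
  | zero =>
    rw [show rankOneSum β y ^ (0 + 1) = rankOneSum β y from pow_one _, rankOneSum]
    refine Fintype.sum_equiv (Equiv.funUnique (Fin 1) E).symm _ _ fun e => ?_
    simp
  | succ k ih =>
    rw [pow_succ', ih, ← (Fin.consEquiv fun _ : Fin (k + 2) => E).sum_comp, Fintype.sum_prod_type,
      rankOneSum, Finset.sum_mul]
    refine Finset.sum_congr rfl fun e _ => ?_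
    rw [Finset.mul_sum]
    refine Finset.sum_congr rfl fun f _ => ?_
    have h1 : ∏ i, y (Fin.consEquiv (fun _ : Fin (k + 2) => E) (e, f) i) = y e * ∏ i, y (f i) := by
      rw [Fin.prod_univ_succ]; rfl
    have h2 : ∏ i : Fin (k + 1), (β (Fin.consEquiv (fun _ : Fin (k + 2) => E) (e, f) i.castSucc) ⬝ᵥ
        β (Fin.consEquiv (fun _ : Fin (k + 2) => E) (e, f) i.succ)) =
        (β e ⬝ᵥ β (f 0)) * ∏ i : Fin k, (β (f i.castSucc) ⬝ᵥ β (f i.succ)) := by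
      rw [Fin.prod_univ_succ]; rfl
    have h3 : Fin.consEquiv (fun _ : Fin (k + 2) => E) (e, f) (Fin.last (k + 1)) =
      f (Fin.last k) := rfl
    have h4 : Fin.consEquiv (fun _ : Fin (k + 2) => E) (e, f) 0 = e := rfl
    rw [h1, h2, h3, h4, Matrix.smul_mul, Matrix.mul_smul, Matrix.vecMulVec_mul_vecMulVec]
    ext i j
    simp only [Matrix.smul_apply, Matrix.vecMulVec_apply, smul_eq_mul, Pi.smul_apply]
    ring

lemma trace_rankOneSum_pow_succ (β : E → V → ℝ) (y : E → ℝ) (k : ℕ) :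
    (rankOneSum β y ^ (k + 1)).trace = ∑ f : Fin (k + 1) → E,
      (∏ i, y (f i)) * ((∏ i : Fin k, (β (f i.castSucc) ⬝ᵥ β (f i.succ))) *
        (β (f 0) ⬝ᵥ β (f (Fin.last k)))) := by
  rw [rankOneSum_pow_succ, Matrix.trace_sum]
  refine Finset.sum_congr rfl fun f _ => ?_
  rw [Matrix.trace_smul, Matrix.trace_vecMulVec, smul_eq_mul, mul_assoc]

/-- Walks of length `k` weighted by `δ` to the power of the number of distinct steps. -/
lemma sum_walk_le {h : E → E → ℝ} {δ : ℝ} (hδ : 0 ≤ δ) (h0 : ∀ e f, 0 ≤ h e f)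
    (h1 : ∀ e f, h e f ≤ 2 * δ) (h2 : ∀ f, ∑ e, h e f ≤ 2) (k : ℕ) :
    ∑ f : Fin (k + 1) → E, δ ^ (Finset.univ.image f).card *
        ∏ i : Fin k, h (f i.castSucc) (f i.succ) ≤
      Fintype.card E * ((2 * (k + 1 : ℕ)) ^ k * δ ^ (k + 1)) := by
  induction k with
  | zero =>
    rw [← (Equiv.funUnique (Fin 1) E).symm.sum_comp]
    simp
  | succ k ih =>
    rw [← (Fin.consEquiv fun _ => E).sum_comp, Fintype.sum_prod_type, Finset.sum_comm]
    -- Prepend a step e. A new e costs a factor δ and its weights h sum to at most 2; a repeated e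
    -- costs no such factor, but there are at most k + 1 of them, each with h at most 2δ. Together:
    -- 2(k + 2)δ.
    have step : ∀ f : Fin (k + 1) → E,
        ∑ e, δ ^ (Finset.univ.image (Fin.consEquiv (fun _ => E) (e, f))).card *
          ∏ i : Fin (k + 1), h (Fin.consEquiv (fun _ => E) (e, f) i.castSucc)
            (Fin.consEquiv (fun _ => E) (e, f) i.succ) ≤
        (2 * (k + 2 : ℕ) * δ) * (δ ^ (Finset.univ.image f).card *
          ∏ i : Fin k, h (f i.castSucc) (f i.succ)) := by
      intro f
      have himg : ∀ e, Finset.univ.image (Fin.consEquiv (fun _ => E) (e, f)) =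
          insert e (Finset.univ.image f) := by
        intro e
        ext z
        simp only [Fin.consEquiv_apply, Finset.mem_image, Finset.mem_univ, true_and,
          Fin.exists_fin_succ, Fin.cons_zero, Fin.cons_succ, Finset.mem_insert]
        tauto
      have hterm : ∀ e, δ ^ (insert e (Finset.univ.image f)).card * h e (f 0) ≤
          δ ^ (Finset.univ.image f).card *
            (δ * h e (f 0) + if e ∈ Finset.univ.image f then 2 * δ else 0) := by
        intro e
        split_ifs with he
        · rw [Finset.insert_eq_of_mem he]
          refine mul_le_mul_of_nonneg_left ?_ (by positivity)
          have := mul_nonneg hδ (h0 e (f 0))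
          linarith [h1 e (f 0)]
        · rw [Finset.card_insert_of_notMem he, pow_succ, add_zero, mul_assoc]
      set W := ∏ i : Fin k, h (f i.castSucc) (f i.succ) with hW
      have hW0 : 0 ≤ W := Finset.prod_nonneg fun i _ => h0 _ _
      calc _ = (∑ e, δ ^ (insert e (Finset.univ.image f)).card * h e (f 0)) * W := by
            rw [Finset.sum_mul]
            refine Finset.sum_congr rfl fun e _ => ?_
            rw [himg, Fin.prod_univ_succ]
            simp only [Fin.consEquiv_apply, Fin.cons_zero, Fin.cons_succ, Fin.castSucc_zero,
              ← Fin.succ_castSucc]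
            rw [mul_assoc]
        _ ≤ (∑ e, δ ^ (Finset.univ.image f).card *
            (δ * h e (f 0) + if e ∈ Finset.univ.image f then 2 * δ else 0)) * W :=
          mul_le_mul_of_nonneg_right (Finset.sum_le_sum fun e _ => hterm e) hW0
        _ = (δ ^ (Finset.univ.image f).card * (δ * ∑ e, h e (f 0) +
              (Finset.univ.image f).card * (2 * δ))) * W := by
            rw [← Finset.mul_sum, Finset.sum_add_distrib, ← Finset.mul_sum, Finset.sum_ite_mem,
              Finset.univ_inter, Finset.sum_const, nsmul_eq_mul]
        _ ≤ (δ ^ (Finset.univ.image f).card * (δ * 2 + (k + 1 : ℕ) * (2 * δ))) * W := by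
            gcongr
            · exact h2 _
            · simpa using Finset.card_image_le (s := Finset.univ) (f := f)
        _ = _ := by push_cast; ring
    refine (Finset.sum_le_sum fun f _ => step f).trans ?_
    rw [← Finset.mul_sum]
    refine (mul_le_mul_of_nonneg_left ih (by positivity)).trans ?_
    have : (2 * ((k + 1 : ℕ) : ℝ)) ^ k ≤ (2 * ((k + 2 : ℕ) : ℝ)) ^ k := by
      gcongr; omega
    calc _ = ((2 * ((k + 1 : ℕ) : ℝ)) ^ k) *
          (2 * (k + 2 : ℕ) * δ * (Fintype.card E * δ ^ (k + 1))) := by ring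
      _ ≤ ((2 * ((k + 2 : ℕ) : ℝ)) ^ k) *
          (2 * (k + 2 : ℕ) * δ * (Fintype.card E * δ ^ (k + 1))) :=
        mul_le_mul_of_nonneg_right this (by positivity)
      _ = _ := by push_cast; ring

end Gram

/-! ### Moments of centred indicators and the trace method -/

section Moments

variable {E V Ω : Type*} [Fintype E] [DecidableEq E] [Fintype V] [DecidableEq V]
  [MeasurableSpace Ω] {μ : Measure Ω} [IsProbabilityMeasure μ]

/-- The indicator of an event, centred at `p`. -/
noncomputable def centredIndicator (p : ℝ) (X : Set Ω) (ω : Ω) : ℝ :=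
  X.indicator (fun _ => (1 : ℝ)) ω - p

lemma abs_centredIndicator_le {p : ℝ} (hp0 : 0 ≤ p) (hp1 : p ≤ 1) (X : Set Ω) (ω : Ω) :
    |centredIndicator p X ω| ≤ 1 := by
  unfold centredIndicator
  by_cases h : ω ∈ X
  · simp only [h, Set.indicator_of_mem]
    exact abs_le.2 ⟨by linarith, by linarith⟩
  · simp only [h, not_false_eq_true, Set.indicator_of_notMem]
    exact abs_le.2 ⟨by linarith, by linarith⟩

lemma measurable_centredIndicator {p : ℝ} {X : Set Ω} (hX : MeasurableSet X) :
    Measurable (centredIndicator p X) :=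
  (measurable_const.indicator hX).sub_const p

lemma integral_centredIndicator {p : ℝ} {X : Set Ω} (hX : MeasurableSet X)
    (hpX : μ.real X = p) : ∫ ω, centredIndicator p X ω ∂μ = 0 := by
  unfold centredIndicator
  rw [integral_sub ((integrable_const _).indicator hX) (integrable_const _),
    integral_indicator_const _ hX]
  simp [hpX]

/-- The variable is bounded by 1, so its higher powers are dominated by its square, of mean p(1 -
p). -/
lemma abs_integral_centredIndicator_pow_le {p : ℝ} (hp0 : 0 ≤ p) (hp1 : p ≤ 1) {X : Set Ω}
    (hX : MeasurableSet X) (hpX : μ.real X = p) {m : ℕ} (hm : 2 ≤ m) :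
    |∫ ω, centredIndicator p X ω ^ m ∂μ| ≤ p := by
  have h1 : ∀ ω, |centredIndicator p X ω ^ m| ≤
      X.indicator (fun _ => (1 : ℝ)) ω * (1 - 2 * p) + p ^ 2 := by
    intro ω
    rw [abs_pow]
    refine (pow_le_pow_of_le_one (abs_nonneg _) (abs_centredIndicator_le hp0 hp1 X ω) hm).trans ?_
    rw [sq_abs]
    unfold centredIndicator
    by_cases h : ω ∈ X <;> simp only [h, Set.indicator_of_mem, not_false_eq_true,
      Set.indicator_of_notMem] <;> nlinarith
  have hi : Integrable (fun ω => X.indicator (fun _ => (1 : ℝ)) ω * (1 - 2 * p) + p ^ 2) μ :=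
    (((integrable_const _).indicator hX).mul_const _).add (integrable_const _)
  refine (abs_integral_le_integral_abs).trans ((integral_mono_of_nonneg
    (Filter.Eventually.of_forall fun _ => abs_nonneg _) hi
    (Filter.Eventually.of_forall h1)).trans ?_)
  rw [integral_add (((integrable_const _).indicator hX).mul_const _) (integrable_const _),
    integral_mul_const, integral_indicator_const _ hX]
  simp only [hpX, smul_eq_mul, integral_const, probReal_univ, mul_one, one_mul]
  nlinarith

lemma integrable_prod_centredIndicator {p : ℝ} (hp0 : 0 ≤ p) (hp1 : p ≤ 1) {X : E → Set Ω}
    (hX : ∀ e, MeasurableSet (X e)) {k : ℕ} (f : Fin k → E) :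
    Integrable (fun ω => ∏ i, centredIndicator p (X (f i)) ω) μ := by
  refine Integrable.of_bound (C := 1) ?_ (Filter.Eventually.of_forall fun ω => ?_)
  · exact (Finset.measurable_fun_prod _ fun i _ =>
      measurable_centredIndicator (hX (f i))).aestronglyMeasurable
  · rw [Real.norm_eq_abs, Finset.abs_prod]
    exact Finset.prod_le_one (fun _ _ => abs_nonneg _)
      fun i _ => abs_centredIndicator_le hp0 hp1 _ _

/-- Mixed moments of `2 * r`-wise independent centred indicators. -/
lemma abs_integral_prod_centredIndicator_le {p D : ℝ} (hp0 : 0 ≤ p) (hp1 : p ≤ 1) (hD : 0 < D)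
    (hpD : 1 ≤ p * D) {X : E → Set Ω} (hX : ∀ e, MeasurableSet (X e))
    (hpX : ∀ e, μ.real (X e) = p) {r : ℕ}
    (hind : ∀ T : Finset E, T.card ≤ 2 * r → iIndepSet (fun e : T => X e) μ)
    (f : Fin (2 * r) → E) :
    |∫ ω, ∏ i, centredIndicator p (X (f i)) ω ∂μ| ≤
      (p * D) ^ r * (1 / D) ^ (Finset.univ.image f).card := by
  set T := Finset.univ.image f with hT
  set m : E → ℕ := fun e => (Finset.univ.filter fun i => f i = e).card with hm
  have hsum : ∑ e ∈ T, m e = 2 * r := by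
    rw [hT, hm, ← Finset.card_eq_sum_card_image]; simp
  have hTr : T.card ≤ 2 * r := by simpa using Finset.card_image_le (s := Finset.univ) (f := f)
  have hfun : ∀ ω, ∏ i, centredIndicator p (X (f i)) ω =
      ∏ e : T, centredIndicator p (X e) ω ^ m e := by
    intro ω
    rw [Finset.prod_comp (fun e => centredIndicator p (X e) ω) f,
      Finset.prod_coe_sort T (fun e => centredIndicator p (X e) ω ^ m e)]
  have hindep : iIndepFun (fun (e : T) ω => centredIndicator p (X e) ω ^ m e) μ := by
    have := ((hind T hTr).iIndepFun_indicator (β := ℝ)).comp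
      (fun (e : T) (z : ℝ) => (z - p) ^ m e) (fun e => by fun_prop)
    exact this
  have hint : ∫ ω, ∏ i, centredIndicator p (X (f i)) ω ∂μ =
      ∏ e : T, ∫ ω, centredIndicator p (X e) ω ^ m e ∂μ := by
    simp_rw [hfun]
    exact hindep.integral_fun_prod_eq_prod_integral fun e =>
      ((measurable_centredIndicator (hX e)).pow_const _).aestronglyMeasurable
  have hm1 : ∀ e ∈ T, 1 ≤ m e := by
    intro e he
    obtain ⟨i, -, rfl⟩ := Finset.mem_image.1 he
    exact Finset.card_pos.2 ⟨i, by simp⟩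
  rw [hint]
  -- An edge occurring exactly once contributes its mean 0. Otherwise at most r distinct edges
  -- occur, each moment is at most p, and 1 ≤ pD allows the exponent of pD to be raised to r.
  by_cases h1 : ∃ e : T, m e = 1
  · obtain ⟨e, he⟩ := h1
    rw [Finset.prod_eq_zero (Finset.mem_univ e)
      (by simp_rw [he, pow_one]; exact integral_centredIndicator (hX e) (hpX e)), abs_zero]
    positivity
  · push Not at h1
    have h2 : ∀ e ∈ T, 2 ≤ m e := fun e he => by
      have := hm1 e he; have := h1 ⟨e, he⟩; simp only at this; omega
    have hcard : T.card ≤ r := by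
      have : T.card * 2 ≤ ∑ e ∈ T, m e := by
        simpa using Finset.card_nsmul_le_sum T m 2 h2
      omega
    rw [Finset.abs_prod]
    calc _ ≤ ∏ _e : T, p := Finset.prod_le_prod (fun _ _ => abs_nonneg _) fun e _ =>
          abs_integral_centredIndicator_pow_le hp0 hp1 (hX e) (hpX e) (h2 e e.2)
      _ = (p * D) ^ T.card * (1 / D) ^ T.card := by
          rw [← mul_pow, mul_assoc, mul_one_div_cancel hD.ne', mul_one]; simp
      _ ≤ _ := by gcongr

lemma integrable_trace_pow {p : ℝ} (hp0 : 0 ≤ p) (hp1 : p ≤ 1) {X : E → Set Ω}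
    (hX : ∀ e, MeasurableSet (X e)) (β : E → V → ℝ) (k : ℕ) :
    Integrable (fun ω =>
      (rankOneSum β (fun e => centredIndicator p (X e) ω) ^ (k + 1)).trace) μ := by
  simp_rw [trace_rankOneSum_pow_succ]
  exact integrable_finsetSum _ fun f _ =>
    (integrable_prod_centredIndicator hp0 hp1 hX f).mul_const _

/-- The moment bound depends on a walk only through its number of distinct edges, which is the
weight in `sum_walk_le` with δ = 1 / D. -/
lemma integral_trace_pow_le {p D : ℝ} (hp0 : 0 ≤ p) (hp1 : p ≤ 1) (hD : 0 < D)
    (hpD : 1 ≤ p * D) {X : E → Set Ω} (hX : ∀ e, MeasurableSet (X e))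
    (hpX : ∀ e, μ.real (X e) = p) {r : ℕ} (hr : 1 ≤ r)
    (hind : ∀ T : Finset E, T.card ≤ 2 * r → iIndepSet (fun e : T => X e) μ)
    {β : E → V → ℝ} (hβ : ∀ e f, |β e ⬝ᵥ β f| ≤ 2 * (1 / D))
    (hβ' : ∀ f, ∑ e, |β e ⬝ᵥ β f| ≤ 2) :
    ∫ ω, (rankOneSum β (fun e => centredIndicator p (X e) ω) ^ (2 * r)).trace ∂μ ≤
      2 * Fintype.card E * ((p * D) ^ r * ((2 * (2 * r : ℕ)) ^ (2 * r) * (1 / D) ^ (2 * r))) := by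
  obtain ⟨k, hk⟩ : ∃ k, 2 * r = k + 1 := ⟨2 * r - 1, by omega⟩
  have hmom := fun f => abs_integral_prod_centredIndicator_le hp0 hp1 hD hpD hX hpX hind f
  rw [hk] at hmom ⊢
  simp_rw [trace_rankOneSum_pow_succ]
  rw [integral_finsetSum _ fun f _ =>
    (integrable_prod_centredIndicator hp0 hp1 hX f).mul_const _]
  simp_rw [integral_mul_const]
  have hb : ∀ f : Fin (k + 1) → E,
      (∫ ω, ∏ i, centredIndicator p (X (f i)) ω ∂μ) *
        ((∏ i : Fin k, (β (f i.castSucc) ⬝ᵥ β (f i.succ))) * (β (f 0) ⬝ᵥ β (f (Fin.last k)))) ≤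
      (2 * (p * D) ^ r) * ((1 / D) ^ (Finset.univ.image f).card *
        ∏ i : Fin k, |β (f i.castSucc) ⬝ᵥ β (f i.succ)|) := by
    intro f
    refine (le_abs_self _).trans ?_
    rw [abs_mul, abs_mul, Finset.abs_prod]
    -- Bounding the closing factor by 2 leaves a sum over open walks.
    have h2 : |β (f 0) ⬝ᵥ β (f (Fin.last k))| ≤ 2 :=
      (Finset.single_le_sum (f := fun e => |β e ⬝ᵥ β (f (Fin.last k))|)
        (fun _ _ => abs_nonneg _) (Finset.mem_univ _)).trans (hβ' _)
    calc _ ≤ ((p * D) ^ r * (1 / D) ^ (Finset.univ.image f).card) *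
          ((∏ i : Fin k, |β (f i.castSucc) ⬝ᵥ β (f i.succ)|) * 2) := by
          gcongr
          exact hmom f
      _ = _ := by ring
  refine (Finset.sum_le_sum fun f _ => hb f).trans ?_
  rw [← Finset.mul_sum]
  have hpD0 : (0 : ℝ) ≤ (p * D) ^ r := by positivity
  refine (mul_le_mul_of_nonneg_left (sum_walk_le (h := fun e f => |β e ⬝ᵥ β f|)
    (δ := 1 / D) (by positivity) (fun _ _ => abs_nonneg _) hβ hβ' k) (by positivity)).trans ?_
  calc _ = (2 * Fintype.card E * (p * D) ^ r * (1 / D) ^ (k + 1)) *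
        (2 * ((k + 1 : ℕ) : ℝ)) ^ k := by ring
    _ ≤ (2 * Fintype.card E * (p * D) ^ r * (1 / D) ^ (k + 1)) *
        (2 * ((k + 1 : ℕ) : ℝ)) ^ (k + 1) := by
      refine mul_le_mul_of_nonneg_left ?_ (by positivity)
      refine pow_le_pow_right₀ ?_ (Nat.le_succ k)
      push_cast
      linarith [(Nat.cast_nonneg k : (0 : ℝ) ≤ k)]
    _ = _ := by ring

lemma trace_rankOneSum_pow_nonneg (β : E → V → ℝ) (y : E → ℝ) (r : ℕ) :
    0 ≤ (rankOneSum β y ^ (2 * r)).trace := by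
  have h := (Matrix.posSemidef_conjTranspose_mul_self (rankOneSum β y ^ r)).trace_nonneg
  rwa [Matrix.conjTranspose_eq_transpose_of_trivial, Matrix.transpose_pow, rankOneSum_transpose,
    ← pow_add, ← two_mul] at h

/-- The event that the trace of a power of the centred sample is large is measurable, unlikely, and
contains every outcome for which the sample misses a vector of large energy. -/
theorem exists_measurableSet_of_trace {p D φ : ℝ} (hp0 : 0 < p) (hp1 : p ≤ 1) (hD : 0 < D)
    (hpD : 1 ≤ p * D) (hφ : 0 < φ) {X : E → Set Ω} (hX : ∀ e, MeasurableSet (X e))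
    (hpX : ∀ e, μ.real (X e) = p) {s : ℕ}
    (hind : ∀ T : Finset E, T.card ≤ 2 ^ (s + 1) → iIndepSet (fun e : T => X e) μ)
    {β : E → V → ℝ} (hβ : ∀ e f, |β e ⬝ᵥ β f| ≤ 2 * (1 / D))
    (hβ' : ∀ f, ∑ e, |β e ⬝ᵥ β f| ≤ 2) :
    ∃ B : Set Ω, MeasurableSet B ∧
      μ.real B ≤ 2 * Fintype.card E * ((4 * 2 ^ (s + 1) * 2 ^ (s + 1)) / (φ ^ 2 * (p * D))) ^ 2 ^ s ∧
      ∀ ω, ∀ x : V → ℝ, 0 < x ⬝ᵥ x → φ * (x ⬝ᵥ x) ≤ ∑ e, (β e ⬝ᵥ x) ^ 2 →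
        (∀ e, ω ∈ X e → β e ⬝ᵥ x = 0) → ω ∈ B := by
  have h2s : 2 ^ (s + 1) = 2 * 2 ^ s := by ring
  have hint := integrable_trace_pow (μ := μ) hp0.le hp1 hX β (2 ^ (s + 1) - 1)
  rw [Nat.sub_add_cancel (Nat.one_le_two_pow)] at hint
  -- The trace is a polynomial in the indicators, so this event is measurable, and Markov's
  -- inequality bounds it.
  refine ⟨{ω | (p * φ) ^ 2 ^ (s + 1) ≤
    (rankOneSum β (fun e => centredIndicator p (X e) ω) ^ 2 ^ (s + 1)).trace}, ?_, ?_, ?_⟩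
  · refine measurableSet_le measurable_const ?_
    obtain ⟨k, hk⟩ : ∃ k, 2 ^ (s + 1) = k + 1 := ⟨2 ^ (s + 1) - 1, by
      rw [Nat.sub_add_cancel (Nat.one_le_two_pow)]⟩
    simp_rw [hk, trace_rankOneSum_pow_succ]
    exact Finset.measurable_fun_sum _ fun f _ => (Finset.measurable_fun_prod _ fun i _ =>
      measurable_centredIndicator (hX (f i))).mul_const _
  · have hE := integral_trace_pow_le (μ := μ) hp0.le hp1 hD hpD hX hpX (r := 2 ^ s)
      Nat.one_le_two_pow (by rwa [← h2s]) hβ hβ'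
    have hM := mul_meas_ge_le_integral_of_nonneg (μ := μ)
      (Filter.Eventually.of_forall fun ω => by
        simp only [Pi.zero_apply]
        rw [h2s]
        exact trace_rankOneSum_pow_nonneg β _ (2 ^ s)) hint ((p * φ) ^ 2 ^ (s + 1))
    rw [← h2s] at hE
    have := hM.trans hE
    rw [mul_comm, ← le_div_iff₀ (by positivity)] at this
    refine this.trans (le_of_eq ?_)
    rw [h2s, pow_mul _ 2, pow_mul _ 2, pow_mul _ 2, ← mul_pow, ← mul_pow, mul_div_assoc,
      ← div_pow]
    congr 2
    push_cast
    field_simp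
    ring
  · intro ω x hx hφx hω
    -- Sampled edges are orthogonal to x, and every other edge has coefficient -p.
    have hval : x ⬝ᵥ (rankOneSum β (fun e => centredIndicator p (X e) ω)).mulVec x =
        -p * ∑ e, (β e ⬝ᵥ x) ^ 2 := by
      rw [dotProduct_rankOneSum_mulVec, Finset.mul_sum]
      refine Finset.sum_congr rfl fun e _ => ?_
      by_cases h : ω ∈ X e
      · rw [hω e h]; simp
      · simp [centredIndicator, h]
    refine pow_le_trace_pow (rankOneSum_transpose _ _) hx (by positivity) ?_ s
    rw [hval, abs_mul, abs_neg, abs_of_pos hp0, mul_assoc]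
    exact mul_le_mul_of_nonneg_left (hφx.trans (le_abs_self _)) hp0.le

end Moments

/-! ### Sampling an expander -/

section Expander

variable {V : Type u} [Fintype V] [DecidableEq V]

/-- The number of edges of `Q` at `v`. -/
def edgeDegree (Q : Finset (Sym2 V)) (v : V) : ℕ := (Q.filter fun e => v ∈ e).card

/-- The edges of `Q` with both ends in `A`. -/
def edgesInside (Q : Finset (Sym2 V)) (A : Finset V) : Finset (Sym2 V) :=
  Q.filter fun e => ∀ v ∈ e, v ∈ A

/-- The edges of `Q` with exactly one end in `A`. -/
def edgeCut (Q : Finset (Sym2 V)) (A : Finset V) : Finset (Sym2 V) :=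
  Q.filter fun e => (∃ v ∈ e, v ∈ A) ∧ ∃ v ∈ e, v ∉ A

/-- The edges `Q` form a graph on the vertex set `S` of minimum degree at least `D` and conductance
at least `φ`. -/
structure IsEdgeExpander (Q : Finset (Sym2 V)) (S : Finset V) (D φ : ℝ) : Prop where
  inside : ∀ e ∈ Q, ∀ v ∈ e, v ∈ S
  not_isDiag : ∀ e ∈ Q, ¬ e.IsDiag
  le_degree : ∀ v ∈ S, D ≤ edgeDegree Q v
  expand : ∀ A ⊆ S, A.Nonempty → 2 * A.card ≤ S.card →
    φ * ∑ v ∈ A, (edgeDegree Q v : ℝ) ≤ (edgeCut Q A).card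

/-- The incidence vector of `e` for the orientation chosen by `Quot.out`. -/
noncomputable def signedIncidence (e : Sym2 V) (v : V) : ℝ :=
  (if v = (Quot.out e).1 then 1 else 0) - (if v = (Quot.out e).2 then 1 else 0)

lemma sym2_out_eq (e : Sym2 V) : s((Quot.out e).1, (Quot.out e).2) = e := Quot.out_eq e

lemma abs_signedIncidence_le (e : Sym2 V) (v : V) :
    |signedIncidence e v| ≤ if v ∈ e then 1 else 0 := by
  have h : v ∈ e ↔ v = (Quot.out e).1 ∨ v = (Quot.out e).2 := by
    conv_lhs => rw [← sym2_out_eq e]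
    rw [Sym2.mem_iff]
  unfold signedIncidence
  by_cases h1 : v = (Quot.out e).1 <;> by_cases h2 : v = (Quot.out e).2
  · rw [if_pos h1, if_pos h2, if_pos (h.2 (Or.inl h1))]; simp
  · rw [if_pos h1, if_neg h2, if_pos (h.2 (Or.inl h1))]; simp
  · rw [if_neg h1, if_pos h2, if_pos (h.2 (Or.inr h2))]; simp
  · rw [if_neg h1, if_neg h2, if_neg (fun hv => (h.1 hv).elim h1 h2)]; simp

/-- The incidence vector normalized by square roots of degrees. -/
noncomputable def normIncidence (Q : Finset (Sym2 V)) (e : Sym2 V) (v : V) : ℝ :=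
  signedIncidence e v / √(edgeDegree Q v)

lemma abs_normIncidence_dotProduct_le (Q : Finset (Sym2 V)) (e f : Sym2 V) :
    |normIncidence Q e ⬝ᵥ normIncidence Q f| ≤
      ∑ v, (if v ∈ e then 1 else 0) * ((if v ∈ f then 1 else 0) * (1 / (edgeDegree Q v : ℝ))) := by
  refine (Finset.abs_sum_le_sum_abs _ _).trans (Finset.sum_le_sum fun v _ => ?_)
  have : normIncidence Q e v * normIncidence Q f v =
      signedIncidence e v * (signedIncidence f v * (1 / (edgeDegree Q v : ℝ))) := by
    unfold normIncidence
    rw [div_mul_div_comm, Real.mul_self_sqrt (Nat.cast_nonneg _)]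
    ring
  rw [this, abs_mul, abs_mul, abs_of_nonneg (show (0 : ℝ) ≤ 1 / (edgeDegree Q v : ℝ) by positivity)]
  have h1 := abs_signedIncidence_le e v
  have h2 := abs_signedIncidence_le f v
  gcongr

lemma sum_ite_mem_sym2 {e : Sym2 V} (he : ¬ e.IsDiag) :
    ∑ v, (if v ∈ e then (1 : ℝ) else 0) = 2 := by
  have : Finset.univ.filter (fun v => v ∈ e) = e.toFinset := by ext v; simp
  rw [Finset.sum_boole, this, Sym2.card_toFinset_of_not_isDiag e he]
  norm_num

/-- Only common endpoints contribute, at most 1 / D each. -/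
lemma IsEdgeExpander.abs_normIncidence_le {Q : Finset (Sym2 V)} {S : Finset V} {D φ : ℝ}
    (hQ : IsEdgeExpander Q S D φ) (hD : 0 < D) {e f : Sym2 V} (he : e ∈ Q) :
    |normIncidence Q e ⬝ᵥ normIncidence Q f| ≤ 2 * (1 / D) := by
  refine (abs_normIncidence_dotProduct_le Q e f).trans ?_
  rw [← sum_ite_mem_sym2 (hQ.not_isDiag e he), Finset.sum_mul]
  refine Finset.sum_le_sum fun v _ => ?_
  by_cases hv : v ∈ e
  · have h1 := hQ.le_degree v (hQ.inside e he v hv)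
    have h2 : 1 / (edgeDegree Q v : ℝ) ≤ 1 / D := one_div_le_one_div_of_le hD h1
    have h3 : 0 ≤ 1 / D := by positivity
    by_cases hf : v ∈ f
    · simpa [hv, hf] using h2
    · simpa [hv, hf] using h3
  · simp [hv]

/-- At each of the two ends v of f, the deg(v) edges through v contribute 1 / deg(v) each. -/
lemma IsEdgeExpander.sum_abs_normIncidence_le {Q : Finset (Sym2 V)} {S : Finset V} {D φ : ℝ}
    (hQ : IsEdgeExpander Q S D φ) {f : Sym2 V} (hf : f ∈ Q) :
    ∑ e : Q, |normIncidence Q e ⬝ᵥ normIncidence Q f| ≤ 2 := by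
  refine (Finset.sum_le_sum fun (e : Q) _ => abs_normIncidence_dotProduct_le Q e f).trans ?_
  rw [Finset.sum_comm, ← sum_ite_mem_sym2 (hQ.not_isDiag f hf)]
  refine Finset.sum_le_sum fun v _ => ?_
  rw [← Finset.sum_mul, Finset.sum_coe_sort Q (fun e => if v ∈ e then (1 : ℝ) else 0),
    Finset.sum_boole]
  by_cases hv : v ∈ f
  · simp only [hv, if_true, one_mul, one_div]
    exact mul_inv_le_one
  · simp [hv]

/-- The indicator of `A` scaled by square roots of degrees. -/
noncomputable def sqrtDegreeIndicator (Q : Finset (Sym2 V)) (A : Finset V) (v : V) : ℝ :=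
  if v ∈ A then √(edgeDegree Q v) else 0

lemma sqrtDegreeIndicator_dotProduct_self (Q : Finset (Sym2 V)) (A : Finset V) :
    sqrtDegreeIndicator Q A ⬝ᵥ sqrtDegreeIndicator Q A = ∑ v ∈ A, (edgeDegree Q v : ℝ) := by
  simp only [dotProduct, sqrtDegreeIndicator, mul_ite, ite_mul, zero_mul, mul_zero]
  rw [← Finset.sum_filter, Finset.filter_univ_mem]
  refine Finset.sum_congr rfl fun v hv => ?_
  rw [if_pos hv, Real.mul_self_sqrt (Nat.cast_nonneg _)]

/-- The root degrees cancel, so the energy of the test vector counts cut edges. Conductance thus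
bounds it directly, without Cheeger's inequality. -/
lemma sq_normIncidence_dotProduct {Q : Finset (Sym2 V)} (A : Finset V) {e : Sym2 V} (he : e ∈ Q) :
    (normIncidence Q e ⬝ᵥ sqrtDegreeIndicator Q A) ^ 2 = if e ∈ edgeCut Q A then 1 else 0 := by
  have hdeg : ∀ v ∈ e, 0 < edgeDegree Q v := fun v hv =>
    Finset.card_pos.2 ⟨e, Finset.mem_filter.2 ⟨he, hv⟩⟩
  have h1 : ∀ v, normIncidence Q e v * sqrtDegreeIndicator Q A v =
      signedIncidence e v * (if v ∈ A then 1 else 0) := by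
    intro v
    unfold normIncidence sqrtDegreeIndicator
    by_cases hv : v ∈ e
    · have : √(edgeDegree Q v : ℝ) ≠ 0 := by
        have := hdeg v hv
        positivity
      split_ifs
      · field_simp
      · simp
    · have := abs_signedIncidence_le e v
      rw [if_neg hv] at this
      rw [abs_nonpos_iff.1 this]
      simp
  have h2 : normIncidence Q e ⬝ᵥ sqrtDegreeIndicator Q A =
      (if (Quot.out e).1 ∈ A then 1 else 0) - (if (Quot.out e).2 ∈ A then 1 else 0) := by
    unfold dotProduct
    simp_rw [h1, signedIncidence, sub_mul, Finset.sum_sub_distrib]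
    simp
  have h3 : e ∈ edgeCut Q A ↔ ¬ ((Quot.out e).1 ∈ A ↔ (Quot.out e).2 ∈ A) := by
    rw [edgeCut, Finset.mem_filter]
    have : ∀ v, v ∈ e ↔ v = (Quot.out e).1 ∨ v = (Quot.out e).2 := fun v => by
      conv_lhs => rw [← sym2_out_eq e]
      rw [Sym2.mem_iff]
    simp only [he, true_and, this, exists_eq_or_imp, exists_eq_left]
    tauto
  rw [h2]
  by_cases ha : (Quot.out e).1 ∈ A <;> by_cases hb : (Quot.out e).2 ∈ A <;> simp [h3, ha, hb]

/-- With high probability a sample of an expander connects all its vertices. -/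
theorem IsEdgeExpander.exists_measurableSet_reachable {Ω : Type v} [MeasurableSpace Ω]
    {μ : Measure Ω} [IsProbabilityMeasure μ] {G : SimpleGraph V} {p : ℝ} {k : ℕ}
    {H : Ω → SimpleGraph V} (hH : IsKWiseSample μ G p k H) (hp0 : 0 < p) (hp1 : p ≤ 1)
    {Q : Finset (Sym2 V)} {S : Finset V} {D φ : ℝ} (hQ : IsEdgeExpander Q S D φ)
    (hQG : (Q : Set (Sym2 V)) ⊆ G.edgeSet) (hD : 0 < D) (hpD : 1 ≤ p * D) (hφ : 0 < φ)
    {s : ℕ} (hs : 2 ^ (s + 1) ≤ k) :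
    ∃ B : Set Ω, MeasurableSet B ∧
      μ.real B ≤ 2 * Q.card * ((4 * 2 ^ (s + 1) * 2 ^ (s + 1)) / (φ ^ 2 * (p * D))) ^ 2 ^ s ∧
      ∀ ω ∉ B, ∀ a ∈ S, ∀ b ∈ S,
        (SimpleGraph.fromEdgeSet {e | e ∈ Q ∧ e ∈ (H ω).edgeSet}).Reachable a b := by
  obtain ⟨B, hBm, hB, hBω⟩ := exists_measurableSet_of_trace (μ := μ) (E := Q) (V := V)
    (X := fun e => {ω | (e : Sym2 V) ∈ (H ω).edgeSet}) hp0 hp1 hD hpD hφ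
    (fun e => hH.measurableSet e (hQG e.2)) (fun e => hH.prob e (hQG e.2)) (s := s)
    (by
      intro T hT
      have h1 := hH.indep (T.map (Function.Embedding.subtype _))
        (by
          intro e he
          simp only [Finset.coe_map, Set.mem_image, Function.Embedding.subtype_apply] at he
          obtain ⟨e', -, rfl⟩ := he
          exact hQG e'.2)
        (by rw [Finset.card_map]; exact hT.trans hs)
      exact h1.precomp (g := fun e : T => (⟨e.1.1, Finset.mem_map.2 ⟨e.1, e.2, rfl⟩⟩ :
        (T.map (Function.Embedding.subtype _) : Finset (Sym2 V))))
        (fun a b hab => by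
          simp only [Subtype.mk.injEq] at hab
          exact Subtype.ext (Subtype.ext hab)))
    (β := fun e => normIncidence Q e) (fun e f => hQ.abs_normIncidence_le hD e.2)
    (fun f => hQ.sum_abs_normIncidence_le f.2)
  refine ⟨B, hBm, by simpa using hB, fun ω hω a ha b hb => ?_⟩
  have key : ∀ A ⊆ S, A.Nonempty → 2 * A.card ≤ S.card →
      ∃ e ∈ edgeCut Q A, e ∈ (H ω).edgeSet := by
    intro A hAS hA hcard
    by_contra hno
    push Not at hno
    refine hω (hBω ω (sqrtDegreeIndicator Q A) ?_ ?_ ?_)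
    · rw [sqrtDegreeIndicator_dotProduct_self]
      exact Finset.sum_pos (fun v hv => hD.trans_le (hQ.le_degree v (hAS hv))) hA
    · rw [sqrtDegreeIndicator_dotProduct_self]
      refine (hQ.expand A hAS hA hcard).trans (le_of_eq ?_)
      rw [Finset.sum_congr rfl fun (e : Q) _ => sq_normIncidence_dotProduct A e.2,
        Finset.sum_coe_sort Q (fun e => if e ∈ edgeCut Q A then (1 : ℝ) else 0),
        Finset.sum_boole]
      congr 2
      ext e
      simp [edgeCut]
    · intro e he
      have h := sq_normIncidence_dotProduct A e.2
      rw [if_neg (fun h' => hno e h' he)] at h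
      exact pow_eq_zero_iff two_ne_zero |>.1 h
  by_contra hab
  set K := SimpleGraph.fromEdgeSet {e | e ∈ Q ∧ e ∈ (H ω).edgeSet} with hK
  classical
  set A := S.filter (fun z => K.Reachable a z) with hA
  have hadj : ∀ e ∈ Q, e ∈ (H ω).edgeSet → ∀ x ∈ e, ∀ y ∈ e, K.Reachable x y := by
    intro e he heH x hx y hy
    by_cases hxy : x = y
    · rw [hxy]
    · have : e = s(x, y) := (Sym2.mem_and_mem_iff hxy).1 ⟨hx, hy⟩
      refine SimpleGraph.Adj.reachable ?_
      rw [hK, SimpleGraph.fromEdgeSet_adj]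
      exact ⟨⟨this ▸ he, this ▸ heH⟩, hxy⟩
  have hcut : ∀ e ∈ Q, e ∈ (H ω).edgeSet → ∀ x ∈ e, ∀ y ∈ e, x ∈ A → y ∈ A := by
    intro e he heH x hx y hy hxA
    rw [hA, Finset.mem_filter] at hxA ⊢
    exact ⟨hQ.inside e he y hy, hxA.2.trans (hadj e he heH x hx y hy)⟩
  -- Expansion is assumed only for sets of at most half of S; a larger component is replaced by its
  -- complement, which contains b.
  rcases le_or_gt (2 * A.card) S.card with h | h
  · obtain ⟨e, he, heH⟩ := key A (Finset.filter_subset _ _)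
      ⟨a, Finset.mem_filter.2 ⟨ha, SimpleGraph.Reachable.refl _⟩⟩ h
    rw [edgeCut, Finset.mem_filter] at he
    obtain ⟨heQ, ⟨x, hx, hxA⟩, ⟨y, hy, hyA⟩⟩ := he
    exact hyA (hcut e heQ heH x hx y hy hxA)
  · have hc : (S \ A).card + A.card = S.card :=
      Finset.card_sdiff_add_card_eq_card (Finset.filter_subset _ _)
    obtain ⟨e, he, heH⟩ := key (S \ A) Finset.sdiff_subset
      ⟨b, Finset.mem_sdiff.2 ⟨hb, fun h => hab (Finset.mem_filter.1 h).2⟩⟩ (by omega)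
    rw [edgeCut, Finset.mem_filter] at he
    obtain ⟨heQ, ⟨x, hx, hxA⟩, ⟨y, hy, hyA⟩⟩ := he
    rw [Finset.mem_sdiff] at hxA hyA
    refine hxA.2 (hcut e heQ heH y hy x hx ?_)
    by_contra hyA'
    exact hyA ⟨hQ.inside e heQ y hy, hyA'⟩

end Expander

/-! ### Expanders inside dense edge sets -/

section ExpanderExistence

variable {V : Type u} [Fintype V] [DecidableEq V]

lemma card_edgesInside_le_add (B : Finset (Sym2 V)) (A S : Finset V) :
    (edgesInside B S).card ≤ (edgesInside B A).card + (edgesInside B (S \ A)).card +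
      (edgeCut (edgesInside B S) A).card := by
  have : edgesInside B S ⊆
      edgesInside B A ∪ edgesInside B (S \ A) ∪ edgeCut (edgesInside B S) A := by
    intro e he
    have he' := he
    rw [edgesInside, Finset.mem_filter] at he'
    by_cases h1 : ∀ v ∈ e, v ∈ A
    · exact Finset.mem_union_left _ (Finset.mem_union_left _ (Finset.mem_filter.2 ⟨he'.1, h1⟩))
    by_cases h2 : ∀ v ∈ e, v ∉ A
    · exact Finset.mem_union_left _ (Finset.mem_union_right _ (Finset.mem_filter.2
        ⟨he'.1, fun v hv => Finset.mem_sdiff.2 ⟨he'.2 v hv, h2 v hv⟩⟩))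
    push Not at h1 h2
    exact Finset.mem_union_right _ (Finset.mem_filter.2 ⟨he, h2, h1⟩)
  exact (Finset.card_le_card this).trans ((Finset.card_union_le _ _).trans
    (Nat.add_le_add_right (Finset.card_union_le _ _) _))

lemma sum_edgeDegree_le {Q : Finset (Sym2 V)} (hQ : ∀ e ∈ Q, ¬ e.IsDiag) (A : Finset V) :
    ∑ v ∈ A, edgeDegree Q v ≤ 2 * (edgesInside Q A).card + (edgeCut Q A).card := by
  have h1 : ∑ v ∈ A, edgeDegree Q v = ∑ e ∈ Q, (A.filter fun v => v ∈ e).card := by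
    simp only [edgeDegree, Finset.card_filter]
    exact Finset.sum_comm
  have h2 : 2 * (edgesInside Q A).card + (edgeCut Q A).card =
      ∑ e ∈ Q, ((if ∀ v ∈ e, v ∈ A then 2 else 0) +
        if (∃ v ∈ e, v ∈ A) ∧ ∃ v ∈ e, v ∉ A then 1 else 0) := by
    rw [Finset.sum_add_distrib, ← Finset.card_filter, ← Finset.sum_filter, Finset.sum_const,
      smul_eq_mul, mul_comm]
    rfl
  rw [h1, h2]
  refine Finset.sum_le_sum fun e he => ?_
  have hsub : A.filter (fun v => v ∈ e) ⊆ e.toFinset := fun v hv => by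
    simpa using (Finset.mem_filter.1 hv).2
  have hcard := Sym2.card_toFinset_of_not_isDiag e (hQ e he)
  by_cases h1 : ∀ v ∈ e, v ∈ A
  · rw [if_pos h1]
    have := Finset.card_le_card hsub
    omega
  · by_cases h2 : ∃ v ∈ e, v ∈ A
    · push Not at h1
      rw [if_pos (⟨h2, h1⟩ : (∃ v ∈ e, v ∈ A) ∧ ∃ v ∈ e, v ∉ A)]
      obtain ⟨v, hv, hvA⟩ := h1
      have : A.filter (fun v => v ∈ e) ⊂ e.toFinset :=
        (Finset.ssubset_iff_of_subset hsub).2 ⟨v, by simpa using hv, by simp [hvA]⟩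
      have := Finset.card_lt_card this
      omega
    · push Not at h2
      rw [Finset.filter_eq_empty_iff.2 fun v hvA hv => h2 v hv hvA]
      simp

/-- A set of at least `2 * D * n * (1 + log₂ n)` edges contains an expander together with a
heavier edge inside its vertex set. -/
theorem exists_isEdgeExpander {w : Sym2 V → ℝ} {B : Finset (Sym2 V)}
    (hw : Set.InjOn w B) (hB : ∀ e ∈ B, ¬ e.IsDiag) [Nonempty V] {D : ℝ} (hD : 1 ≤ D)
    (hcard : 2 * D * (Fintype.card V * (1 + Real.logb 2 (Fintype.card V))) ≤ B.card) :
    ∃ e ∈ B, ∃ Q ⊆ B, ∃ S : Finset V, (∀ f ∈ Q, w f < w e) ∧ (∀ v ∈ e, v ∈ S) ∧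
      IsEdgeExpander Q S D (1 / (4 * (1 + Real.logb 2 (Fintype.card V)) + 1)) := by
  set P : Finset V → Prop := fun S => S.Nonempty ∧
    2 * D * (S.card * (1 + Real.logb 2 S.card)) ≤ (edgesInside B S).card with hP
  have huniv : P Finset.univ := by
    refine ⟨Finset.univ_nonempty, ?_⟩
    rw [Finset.card_univ]
    refine hcard.trans (le_of_eq ?_)
    congr 2
    simp [edgesInside]
  -- A smallest vertex set above the density threshold has no sparse cut, since otherwise one of the
  -- two sides would be above the threshold.
  obtain ⟨S, ⟨hSne, hS⟩, hmin⟩ : ∃ S, P S ∧ ∀ A, P A → S.card ≤ A.card := by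
    classical
    obtain ⟨S, hS, hmin⟩ := (Finset.univ.filter P).exists_min_image Finset.card
      ⟨Finset.univ, by simpa using huniv⟩
    exact ⟨S, (Finset.mem_filter.1 hS).2, fun A hA => hmin A (by simpa using hA)⟩
  have hsmall : ∀ A : Finset V, A.Nonempty → A.card < S.card →
      ((edgesInside B A).card : ℝ) < 2 * D * (A.card * (1 + Real.logb 2 A.card)) := by
    intro A hA hAS
    by_contra h
    push Not at h
    exact absurd (hmin A ⟨hA, h⟩) (by omega)
  have hSpos : (1 : ℝ) ≤ S.card := by exact_mod_cast hSne.card_pos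
  have hlogS : 0 ≤ Real.logb 2 S.card := Real.logb_nonneg (by norm_num) hSpos
  have hlogSn : Real.logb 2 S.card ≤ Real.logb 2 (Fintype.card V) :=
    Real.logb_le_logb_of_le (by norm_num) (by linarith) (by exact_mod_cast Finset.card_le_univ S)
  set I := edgesInside B S with hI
  have hIpos : 0 < I.card := by
    have : (0 : ℝ) < I.card := lt_of_lt_of_le (by positivity) hS
    exact_mod_cast this
  have hIB : I ⊆ B := Finset.filter_subset _ _
  obtain ⟨e, heI, hemax⟩ := I.exists_max_image w (Finset.card_pos.1 hIpos)
  have hSin : ∀ f ∈ I, ∀ v ∈ f, v ∈ S := fun f hf => (Finset.mem_filter.1 hf).2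
  have hS2 : 2 ≤ S.card := by
    by_contra h
    have h1 : S.card ≤ 1 := by omega
    refine hB e (hIB heI) ?_
    have := hSin e heI
    induction e with
    | h a b =>
      rw [Sym2.mk_isDiag_iff]
      exact Finset.card_le_one.1 h1 a (this a (Sym2.mem_mk_left a b)) b
        (this b (Sym2.mem_mk_right a b))
  set Q := I.erase e with hQ
  have hQI : Q ⊆ I := Finset.erase_subset _ _
  have hcut : ∀ A ⊆ S, A.Nonempty → 2 * A.card ≤ S.card → D * A.card ≤ (edgeCut Q A).card := by
    intro A hAS hA hcardA
    have hApos := hA.card_pos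
    have hA1 : (1 : ℝ) ≤ A.card := by exact_mod_cast hApos
    have hsd : (S \ A).card + A.card = S.card := Finset.card_sdiff_add_card_eq_card hAS
    have h1 := hsmall A hA (by omega)
    have h2 := hsmall (S \ A) (Finset.card_pos.1 (by omega)) (by omega)
    have h3 : (I.card : ℝ) ≤ (edgesInside B A).card + (edgesInside B (S \ A)).card +
      (edgeCut I A).card := by exact_mod_cast card_edgesInside_le_add B A S
    have h4 : ((edgeCut I A).card : ℝ) ≤ (edgeCut Q A).card + 1 := by
      have : edgeCut Q A = (edgeCut I A).erase e := by
        rw [edgeCut, edgeCut, hQ, Finset.filter_erase]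
      rw [this]
      have h := Finset.pred_card_le_card_erase (s := edgeCut I A) (a := e)
      have : (edgeCut I A).card ≤ ((edgeCut I A).erase e).card + 1 := by omega
      exact_mod_cast this
    -- The logarithm in the threshold pays for the cut: on the smaller side it drops by at least 1,
    -- which forces 2D|A| cut edges. Removing e loses at most one of them, and 1 ≤ D|A|.
    have h5 : 1 + Real.logb 2 A.card ≤ Real.logb 2 S.card := by
      have : (1 : ℝ) + Real.logb 2 A.card = Real.logb 2 (2 * A.card) := by
        rw [Real.logb_mul (by norm_num) (by linarith), Real.logb_self_eq_one (by norm_num)]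
      rw [this]
      exact Real.logb_le_logb_of_le (by norm_num) (by linarith) (by exact_mod_cast hcardA)
    have hsdR : ((S \ A).card : ℝ) = S.card - A.card := by
      rw [← hsd]; push_cast; ring
    have hsd1 : (1 : ℝ) ≤ (S \ A).card := by
      have : 1 ≤ (S \ A).card := by omega
      exact_mod_cast this
    have h6 : Real.logb 2 (S \ A).card ≤ Real.logb 2 S.card :=
      Real.logb_le_logb_of_le (by norm_num) (by linarith) (by rw [hsdR]; linarith)
    have h7 : 2 * D * (A.card * (1 + Real.logb 2 A.card)) ≤
        2 * D * (A.card * Real.logb 2 S.card) := by gcongr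
    have h8 : 2 * D * ((S \ A).card * (1 + Real.logb 2 (S \ A).card)) ≤
        2 * D * ((S.card - A.card) * (1 + Real.logb 2 S.card)) := by
      rw [← hsdR]; gcongr
    have h9 : 1 ≤ D * A.card := one_le_mul_of_one_le_of_one_le hD hA1
    nlinarith
  have hQdiag : ∀ f ∈ Q, ¬ f.IsDiag := fun f hf => hB f (hIB (hQI hf))
  refine ⟨e, hIB heI, Q, hQI.trans hIB, S, fun f hf => ?_, hSin e heI, ?_, hQdiag, ?_, ?_⟩
  · have hf' := Finset.mem_erase.1 hf
    refine lt_of_le_of_ne (hemax f hf'.2) fun h => hf'.1 ?_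
    exact hw (hIB hf'.2) (hIB heI) h
  · exact fun f hf => hSin f (hQI hf)
  · intro v hv
    have h1 := hcut {v} (by simpa using hv) (by simp) (by simpa using hS2)
    have h2 : (edgeCut Q {v}).card ≤ edgeDegree Q v := by
      refine Finset.card_le_card fun f hf => ?_
      rw [edgeCut, Finset.mem_filter] at hf
      obtain ⟨hfQ, ⟨x, hx, hxv⟩, -⟩ := hf
      rw [Finset.mem_singleton] at hxv
      exact Finset.mem_filter.2 ⟨hfQ, hxv ▸ hx⟩
    have h3 : ((edgeCut Q {v}).card : ℝ) ≤ edgeDegree Q v := by exact_mod_cast h2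
    simp only [Finset.card_singleton, Nat.cast_one, mul_one] at h1
    linarith
  · intro A hAS hA hcardA
    have hApos := hA.card_pos
    have hA1 : (1 : ℝ) ≤ A.card := by exact_mod_cast hApos
    have h1 := hcut A hAS hA hcardA
    have h2 := hsmall A hA (by omega)
    have h3 : ((edgesInside Q A).card : ℝ) ≤ (edgesInside B A).card := by
      have : edgesInside Q A ⊆ edgesInside B A := Finset.filter_subset_filter _ (hQI.trans hIB)
      exact_mod_cast Finset.card_le_card this
    have h4 : (∑ v ∈ A, (edgeDegree Q v : ℝ)) ≤
        2 * (edgesInside Q A).card + (edgeCut Q A).card := by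
      exact_mod_cast sum_edgeDegree_le hQdiag A
    set ℓ := 1 + Real.logb 2 (Fintype.card V) with hℓ
    have hℓ1 : 1 ≤ ℓ := by linarith
    have h5 : Real.logb 2 A.card ≤ Real.logb 2 S.card :=
      Real.logb_le_logb_of_le (by norm_num) (by linarith)
        (by exact_mod_cast Finset.card_le_card hAS)
    have h6 : 2 * D * (A.card * (1 + Real.logb 2 A.card)) ≤ 2 * ℓ * (D * A.card) := by
      have : A.card * (1 + Real.logb 2 A.card) ≤ A.card * ℓ := by
        gcongr; linarith
      nlinarith
    have h7 : 2 * ℓ * (D * A.card) ≤ 2 * ℓ * (edgeCut Q A).card := by gcongr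
    -- The degree sum is at most 2 · 2ℓD|A| plus the cut, and D|A| is at most the cut; this gives 4ℓ
    -- + 1.
    rw [one_div, inv_mul_le_iff₀ (by linarith)]
    linarith

end ExpanderExistence

/-! ### Counting light edges -/

section LightEdges

variable {V : Type u} [Fintype V] [DecidableEq V]

/-- `e` lies in the vertex set of an expander consisting of lighter edges of `G`. -/
def IsExpanderSpanned (w : Sym2 V → ℝ) (G : SimpleGraph V) (D φ : ℝ) (e : Sym2 V) : Prop :=
  ∃ (Q : Finset (Sym2 V)) (S : Finset V), (Q : Set (Sym2 V)) ⊆ G.edgeSet ∧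
    (∀ f ∈ Q, w f < w e) ∧ (∀ v ∈ e, v ∈ S) ∧ IsEdgeExpander Q S D φ

/-- If there were more such edges, `exists_isEdgeExpander` applied to the set of them would span one
of its own members. -/
lemma ncard_not_isExpanderSpanned_le {w : Sym2 V → ℝ} {G : SimpleGraph V}
    (hw : Set.InjOn w G.edgeSet) [Nonempty V] {D : ℝ} (hD : 1 ≤ D) :
    ({e | e ∈ G.edgeSet ∧ ¬ IsExpanderSpanned w G D
        (1 / (4 * (1 + Real.logb 2 (Fintype.card V)) + 1)) e}.ncard : ℝ) ≤
      2 * D * (Fintype.card V * (1 + Real.logb 2 (Fintype.card V))) := by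
  classical
  set φ := 1 / (4 * (1 + Real.logb 2 (Fintype.card V)) + 1)
  set B := (Set.toFinite {e | e ∈ G.edgeSet ∧ ¬ IsExpanderSpanned w G D φ e}).toFinset with hB
  rw [Set.ncard_eq_toFinset_card _ (Set.toFinite _), ← hB]
  have hmem : ∀ e, e ∈ B ↔ e ∈ G.edgeSet ∧ ¬ IsExpanderSpanned w G D φ e := by simp [hB]
  by_contra h
  push Not at h
  obtain ⟨e, he, Q, hQ, S, hlt, heS, hexp⟩ := exists_isEdgeExpander (w := w) (B := B)
    (hw.mono fun e he => ((hmem e).1 he).1)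
    (fun e he => G.not_isDiag_of_mem_edgeSet ((hmem e).1 he).1) hD h.le
  exact ((hmem e).1 he).2 ⟨Q, S, fun f hf => ((hmem f).1 (hQ hf)).1, hlt, heS, hexp⟩

lemma card_finset_sym2_le (Q : Finset (Sym2 V)) : (Q.card : ℝ) ≤ (Fintype.card V : ℝ) ^ 2 := by
  have h := Finset.card_le_univ Q
  have h2 : Fintype.card (Sym2 V) ≤ Fintype.card (V × V) :=
    Fintype.card_le_of_surjective (fun z : V × V => s(z.1, z.2)) fun e => by
      induction e with | h a b => exact ⟨(a, b), rfl⟩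
  rw [Fintype.card_prod] at h2
  rw [sq]
  exact_mod_cast h.trans h2

/-- An edge spanned by an expander of lighter edges is unlikely to be light. -/
lemma IsExpanderSpanned.exists_measurableSet {Ω : Type v} [MeasurableSpace Ω]
    {μ : Measure Ω} [IsProbabilityMeasure μ] {w : Sym2 V → ℝ} {G : SimpleGraph V} {p : ℝ} {k : ℕ}
    {H F : Ω → SimpleGraph V} (hH : IsKWiseSample μ G p k H)
    (hF : ∀ ω, IsMinWeightForest w (H ω) (F ω)) (hp0 : 0 < p) (hp1 : p ≤ 1)
    {D φ : ℝ} (hD : 0 < D) (hpD : 1 ≤ p * D) (hφ : 0 < φ)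
    {s : ℕ} (hs : 2 ^ (s + 1) ≤ k) {e : Sym2 V} (he : IsExpanderSpanned w G D φ e) :
    ∃ B : Set Ω, MeasurableSet B ∧
      μ.real B ≤ 2 * (Fintype.card V : ℝ) ^ 2 *
        ((4 * 2 ^ (s + 1) * 2 ^ (s + 1)) / (φ ^ 2 * (p * D))) ^ 2 ^ s ∧
      ∀ ω ∉ B, e ∉ lightEdges w G (F ω) := by
  obtain ⟨Q, S, hQG, hlt, heS, hQ⟩ := he
  obtain ⟨B, hBm, hB, hBω⟩ := hQ.exists_measurableSet_reachable hH hp0 hp1 hQG hD hpD hφ hs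
  refine ⟨B, hBm, hB.trans ?_, fun ω hω hlight => ?_⟩
  · gcongr
    exact card_finset_sym2_le Q
  · induction e with
    | h a b =>
      have hr := hBω ω hω a (heS a (Sym2.mem_mk_left a b)) b (heS b (Sym2.mem_mk_right a b))
      refine absurd (hlight.2 a b rfl) (not_le.2 ((hF ω).maxPathWeight_lt (hr.mono ?_)))
      intro x y hxy
      rw [SimpleGraph.fromEdgeSet_adj] at hxy
      exact edgesBelow_adj.2 ⟨hxy.1.2, hlt _ hxy.1.1⟩

/-- The number of light edges is bounded by the number of edges not spanned by a lighter expander,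
with a failure probability given by a union bound. -/
theorem measureReal_ncard_lightEdges_le {Ω : Type v} [MeasurableSpace Ω]
    {μ : Measure Ω} [IsProbabilityMeasure μ] {w : Sym2 V → ℝ} {G : SimpleGraph V}
    (hw : Set.InjOn w G.edgeSet) [Nonempty V] {p : ℝ} {k : ℕ}
    {H F : Ω → SimpleGraph V} (hH : IsKWiseSample μ G p k H)
    (hF : ∀ ω, IsMinWeightForest w (H ω) (F ω)) (hp0 : 0 < p) (hp1 : p ≤ 1)
    {D φ : ℝ} (hD : 1 ≤ D) (hpD : 1 ≤ p * D)
    (hφ : φ = 1 / (4 * (1 + Real.logb 2 (Fintype.card V)) + 1)) (hφ0 : 0 < φ)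
    {s : ℕ} (hs : 2 ^ (s + 1) ≤ k) :
    1 - 2 * (Fintype.card V : ℝ) ^ 4 *
        ((4 * 2 ^ (s + 1) * 2 ^ (s + 1)) / (φ ^ 2 * (p * D))) ^ 2 ^ s ≤
      μ.real {ω | ((lightEdges w G (F ω)).ncard : ℝ) ≤
        2 * D * (Fintype.card V * (1 + Real.logb 2 (Fintype.card V)))} := by
  set q := ((4 * 2 ^ (s + 1) * 2 ^ (s + 1)) / (φ ^ 2 * (p * D))) ^ 2 ^ s with hq
  have hq0 : 0 ≤ q := by positivity
  have hex : ∀ e : Sym2 V, ∃ B : Set Ω, MeasurableSet B ∧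
      μ.real B ≤ 2 * (Fintype.card V : ℝ) ^ 2 * q ∧
      (IsExpanderSpanned w G D φ e → ∀ ω ∉ B, e ∉ lightEdges w G (F ω)) := by
    intro e
    by_cases he : IsExpanderSpanned w G D φ e
    · obtain ⟨B, h1, h2, h3⟩ := he.exists_measurableSet hH hF hp0 hp1 (by linarith) hpD hφ0 hs
      exact ⟨B, h1, h2, fun _ => h3⟩
    · exact ⟨∅, MeasurableSet.empty, by simp; positivity, fun h => absurd h he⟩
  choose B hBm hB hBω using hex
  have hunion : μ.real (⋃ e, B e) ≤ 2 * (Fintype.card V : ℝ) ^ 4 * q := by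
    refine (measureReal_iUnion_fintype_le B).trans ((Finset.sum_le_sum fun e _ => hB e).trans ?_)
    rw [Finset.sum_const, nsmul_eq_mul]
    calc _ ≤ (Fintype.card V : ℝ) ^ 2 * (2 * (Fintype.card V : ℝ) ^ 2 * q) := by
          gcongr
          exact card_finset_sym2_le _
      _ = _ := by ring
  have hcompl : μ.real (⋃ e, B e)ᶜ = 1 - μ.real (⋃ e, B e) :=
    probReal_compl_eq_one_sub (MeasurableSet.iUnion hBm)
  -- F need not depend measurably on ω, so the bound is taken on the complement of the measurable
  -- bad events and transferred by monotonicity.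
  refine le_trans (by linarith : _ ≤ μ.real (⋃ e, B e)ᶜ) (measureReal_mono fun ω hω => ?_)
  refine le_trans ?_ (ncard_not_isExpanderSpanned_le hw hD)
  rw [← hφ]
  refine Nat.cast_le.2 (Set.ncard_le_ncard (fun e he => ⟨he.1, fun hsp => ?_⟩) (Set.toFinite _))
  exact hBω e hsp ω (fun h => hω (Set.mem_iUnion.2 ⟨e, h⟩)) he

lemma ncard_lightEdges_le (w : Sym2 V → ℝ) (G F : SimpleGraph V) :
    ((lightEdges w G F).ncard : ℝ) ≤ (Fintype.card V : ℝ) ^ 2 := by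
  classical
  rw [Set.ncard_eq_toFinset_card _ (Set.toFinite _)]
  exact card_finset_sym2_le _

end LightEdges

/-! ### Choice of parameters -/

/-- Take the largest power of two up to ⌈x⌉; rounding up is harmless because k is an integer. -/
lemma exists_two_pow_near {x : ℝ} (hx : 2 ≤ x) :
    ∃ s : ℕ, (∀ k : ℕ, x ≤ k → 2 ^ (s + 1) ≤ k) ∧ (2 : ℝ) ^ (s + 1) ≤ 2 * x ∧
      x / 4 ≤ (2 ^ s : ℕ) := by
  have hm2 : 2 ≤ ⌈x⌉₊ := by exact_mod_cast hx.trans (Nat.le_ceil x)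
  have hlog : 1 ≤ Nat.log 2 ⌈x⌉₊ := Nat.log_pos (by norm_num) hm2
  obtain ⟨s, hs⟩ : ∃ s, Nat.log 2 ⌈x⌉₊ = s + 1 := ⟨_, (Nat.sub_add_cancel hlog).symm⟩
  have h1 : 2 ^ (s + 1) ≤ ⌈x⌉₊ := hs ▸ Nat.pow_log_le_self 2 (by omega)
  have h2 : ⌈x⌉₊ < 2 ^ (s + 2) := by
    have := Nat.lt_pow_succ_log_self (b := 2) (by norm_num) ⌈x⌉₊
    rwa [hs] at this
  refine ⟨s, fun k hk => h1.trans (Nat.ceil_le.2 hk), ?_, ?_⟩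
  · have h3 : ((2 ^ (s + 1) : ℕ) : ℝ) ≤ ⌈x⌉₊ := by exact_mod_cast h1
    have h4 := Nat.ceil_lt_add_one (show 0 ≤ x by linarith)
    push_cast at h3
    linarith
  · have h3 : (⌈x⌉₊ : ℝ) < ((2 ^ (s + 2) : ℕ) : ℝ) := by exact_mod_cast h2
    have h4 := Nat.le_ceil x
    push_cast at h3 ⊢
    rw [pow_add] at h3
    linarith

/-- The constant 24 / c makes the r-th power at most n⁻⁶, which beats the union bound factor 2n⁴. -/
lemma two_mul_pow_mul_pow_le {n L c b : ℝ} (hn : 2 ≤ n) (hL : L = Real.log n) (hc : 0 < c) {r : ℕ}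
    (hr : c * L / 4 ≤ r) (hb0 : 0 ≤ b) (hb : b ≤ Real.exp (-(24 / c))) :
    2 * n ^ 4 * b ^ r ≤ 1 / n := by
  have hn0 : 0 < n := by linarith
  have h1 : b ^ r ≤ Real.exp (-(6 * L)) := by
    refine (pow_le_pow_left₀ hb0 hb r).trans ?_
    rw [← Real.exp_nat_mul, Real.exp_le_exp]
    have h2 : c * L / 4 * (24 / c) ≤ r * (24 / c) := by gcongr
    have h3 : c * L / 4 * (24 / c) = 6 * L := by field_simp; ring
    linarith
  have h4 : Real.exp (-(6 * L)) = 1 / n ^ 6 := by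
    rw [Real.exp_neg, hL, one_div]
    congr 1
    rw [mul_comm, Real.exp_mul, Real.exp_log hn0]
    norm_cast
  rw [h4] at h1
  calc 2 * n ^ 4 * b ^ r ≤ 2 * n ^ 4 * (1 / n ^ 6) := by gcongr
    _ = 2 / n * (1 / n) := by field_simp
    _ ≤ 1 * (1 / n) := by
      gcongr
      rw [div_le_one hn0]
      exact hn
    _ = _ := one_mul _

theorem mainTheorem6 (c : ℝ) (hc : 0 < c) :
    ∃ (C : ℝ) (A : ℕ), 0 < C ∧
      ∀ (V : Type u) [Fintype V] (G : SimpleGraph V) (w : Sym2 V → ℝ),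
        Set.InjOn w G.edgeSet →
      ∀ (p : ℝ), 0 < p → p ≤ 1 →
      ∀ (k : ℕ), c * Real.log (Fintype.card V) ≤ (k : ℝ) →
      ∀ (Ω : Type v) [MeasurableSpace Ω] (μ : Measure Ω) [IsProbabilityMeasure μ]
        (H F : Ω → SimpleGraph V),
        IsKWiseSample μ G p k H →
        (∀ ω, IsMinWeightForest w (H ω) (F ω)) →
        1 - 1 / (Fintype.card V : ℝ) ≤
          μ.real {ω | ((lightEdges w G (F ω)).ncard : ℝ) ≤
            C * (Real.log (Fintype.card V)) ^ A * (Fintype.card V / p)} := by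
  classical
  -- Here 2704 = 4 · 2² · 13²: the factor 4 of the trace bound, 2^(s+1) ≤ 2cL twice, and φ ≥ 1 /
  -- (13L) squared. Beyond T, both 1 ≤ L and 2 ≤ cL hold.
  set C₁ : ℝ := 2704 * c ^ 2 * Real.exp (24 / c) with hC₁
  set T : ℝ := max 1 (2 / c) with hT
  have hC₁0 : 0 < C₁ := by positivity
  refine ⟨6 * C₁ + 32 * Real.exp T, 5, by positivity, ?_⟩
  intro V _ G w hw p hp0 hp1 k hk Ω _ μ _ H F hH hF
  set n : ℝ := (Fintype.card V : ℝ) with hn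
  set L := Real.log n with hL
  have hn0 : 0 ≤ n := Nat.cast_nonneg _
  have hnp : n ≤ n / p := le_div_self hn0 hp0 hp1
  have htriv : (∀ ω, ((lightEdges w G (F ω)).ncard : ℝ) ≤
      (6 * C₁ + 32 * Real.exp T) * L ^ 5 * (n / p)) → 1 - 1 / n ≤
      μ.real {ω | ((lightEdges w G (F ω)).ncard : ℝ) ≤
        (6 * C₁ + 32 * Real.exp T) * L ^ 5 * (n / p)} := by
    intro h
    have : {ω | ((lightEdges w G (F ω)).ncard : ℝ) ≤
        (6 * C₁ + 32 * Real.exp T) * L ^ 5 * (n / p)} = Set.univ := Set.eq_univ_of_forall h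
    rw [this, probReal_univ]
    have : 0 ≤ 1 / n := by positivity
    linarith
  have hL0 : 0 ≤ L := Real.log_natCast_nonneg _
  rcases le_or_gt (Fintype.card V) 1 with hcard | hcard
  · refine htriv fun ω => ?_
    have : Subsingleton V := Fintype.card_le_one_iff_subsingleton.1 hcard
    have hempty : lightEdges w G (F ω) = ∅ := by
      rw [Set.eq_empty_iff_forall_notMem]
      intro e he
      refine G.not_isDiag_of_mem_edgeSet he.1 ?_
      induction e with | h a b => exact Sym2.mk_isDiag_iff.2 (Subsingleton.elim a b)
    rw [hempty, Set.ncard_empty, Nat.cast_zero]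
    positivity
  have hn2 : 2 ≤ n := by rw [hn]; exact_mod_cast hcard
  have hnexp : n = Real.exp L := (Real.exp_log (by linarith)).symm
  -- For bounded n the trivial bound n² suffices; 32 = 2⁵ compensates for L being possibly as small
  -- as log 2 > 1/2.
  rcases lt_or_ge L T with hLT | hLT
  · refine htriv fun ω => (ncard_lightEdges_le w G (F ω)).trans ?_
    have h1 : (1 / 2 : ℝ) ≤ L := by
      have := Real.log_two_gt_d9
      have : Real.log 2 ≤ L := Real.log_le_log (by norm_num) hn2
      linarith
    have h2 : (1 / 2 : ℝ) ^ 5 ≤ L ^ 5 := by gcongr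
    have h3 : n ≤ Real.exp T := by rw [hnexp]; exact Real.exp_le_exp.2 hLT.le
    calc n ^ 2 = n * n := sq n
      _ ≤ Real.exp T * (n / p) := by gcongr
      _ = 32 * Real.exp T * (1 / 2) ^ 5 * (n / p) := by ring
      _ ≤ (6 * C₁ + 32 * Real.exp T) * L ^ 5 * (n / p) := by
        gcongr
        linarith
  have hL1 : 1 ≤ L := (le_max_left _ _).trans hLT
  have hcL : 2 ≤ c * L := by
    have : 2 / c ≤ L := (le_max_right _ _).trans hLT
    rwa [div_le_iff₀ hc, mul_comm] at this
  have hne : Nonempty V := Fintype.card_pos_iff.1 (by omega)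
  obtain ⟨s, hsk, hs1, hs2⟩ := exists_two_pow_near hcL
  have hpD : p * (C₁ * L ^ 4 / p) = C₁ * L ^ 4 := by field_simp
  have hbig : 1 ≤ C₁ * L ^ 4 := by
    have h1 : 1 ≤ Real.exp (24 / c) := Real.one_le_exp (by positivity)
    have h2 : 1 ≤ L ^ 2 := one_le_pow₀ hL1
    have h3 : 4 ≤ (c * L) ^ 2 := by nlinarith
    calc (1 : ℝ) ≤ 2704 * 4 * 1 * 1 := by norm_num
      _ ≤ 2704 * (c * L) ^ 2 * Real.exp (24 / c) * L ^ 2 := by gcongr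
      _ = C₁ * L ^ 4 := by rw [hC₁]; ring
  have hD : 1 ≤ C₁ * L ^ 4 / p := hbig.trans (le_div_self (by positivity) hp0 hp1)
  have hlogb : Real.logb 2 n ≤ 2 * L := by
    rw [Real.logb, div_le_iff₀ (Real.log_pos (by norm_num))]
    have := Real.log_two_gt_d9
    nlinarith
  have hlogb0 : 0 ≤ Real.logb 2 n := Real.logb_nonneg (by norm_num) (by linarith)
  set φ := 1 / (4 * (1 + Real.logb 2 n) + 1) with hφ
  have hφ0 : 0 < φ := by positivity
  have hφ1 : 1 / (13 * L) ≤ φ := one_div_le_one_div_of_le (by positivity) (by linarith)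
  have hmain := measureReal_ncard_lightEdges_le (μ := μ) hw hH hF hp0 hp1 hD
    (by rw [hpD]; exact hbig) hφ hφ0 (hsk k hk)
  refine le_trans ?_ (hmain.trans (measureReal_mono fun ω hω => ?_))
  · have hb : (4 * 2 ^ (s + 1) * 2 ^ (s + 1)) / (φ ^ 2 * (p * (C₁ * L ^ 4 / p))) ≤
        Real.exp (-(24 / c)) := by
      rw [hpD]
      calc _ ≤ (4 * (2 * (c * L)) * (2 * (c * L))) / ((1 / (13 * L)) ^ 2 * (C₁ * L ^ 4)) := by
            gcongr
        _ = _ := by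
          rw [Real.exp_neg, hC₁]
          field_simp
          norm_num
    have := two_mul_pow_mul_pow_le hn2 hL hc hs2 (by positivity) hb
    linarith
  · rw [Set.mem_ofPred_eq] at hω ⊢
    refine hω.trans ?_
    calc 2 * (C₁ * L ^ 4 / p) * (n * (1 + Real.logb 2 n))
        ≤ 2 * (C₁ * L ^ 4 / p) * (n * (3 * L)) := by gcongr; linarith
      _ = 6 * C₁ * L ^ 5 * (n / p) := by ring
      _ ≤ (6 * C₁ + 32 * Real.exp T) * L ^ 5 * (n / p) := by
        gcongr
        linarith [Real.exp_pos T]
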